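/- **Theorem D** (with coefficients in $\mathcal A$). Let $L$ be a functional first-order language (no predicate symbols), $\mathcal A$ a (non-empty) $L$-algebra, and $L_{\mathcal A}=L\cup\{c_a\mid a\in A\}$. An $\mathcal A$-algebra is an $L_{\mathcal A}$-algebra satisfying $\mathrm{Diag}(\mathcal A)$, the set of all atomic $L_{\mathcal A}$-sentences and negations of such that are true in $\mathcal A$. Let $\mathcal B$ be an $\mathcal A$-algebra which is $\mathcal A$-equationally Noetherian: for every $n\ge 1$ every system $S$ of $L_{\mathcal A}$-equations $t_1=t_2$ in $x_1,\dots,x_n$ has a finite subsystem $S_0\subseteq S$ with the same set of solutions $V_{\mathcal B}(S)=V_{\mathcal B}(S_0)\subseteq B^n$. Let $\mathcal C$ be an $\mathcal A$-algebra that is finitely generated as an $L_{\mathcal A}$-algebra. Then the following conditions are equivalent (all notions are in the language $L_{\mathcal A}$; products over the empty index set are the trivial algebra): 1. $\mathcal C\in\mathbf{Qvar}_{\mathcal A}(\mathcal B)=\mathrm{Mod}(\mathrm{Th}_{\mathrm{qi},\mathcal A}(\mathcal B))$, i.e. $\mathrm{Th}_{\mathrm{qi},\mathcal A}(\mathcal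 B)\subseteq \mathrm{Th}_{\mathrm{qi},\mathcal A}(\mathcal C)$, where $\mathrm{Th}_{\mathrm{qi},\mathcal A}$ is the set of all true quasi-identities $\forall x_1\dots x_n\,(\bigwedge_{k=1}^m t_k=s_k\to t=s)$ of $L_{\mathcal A}$; 2. $\mathcal C\in\mathbf{Pvar}_{\mathcal A}(\mathcal B)$, the least class of $L_{\mathcal A}$-algebras that contains $\mathcal B$ and is closed under isomorphic copies, subalgebras and direct products; 3. $\mathcal C$ embeds, by an $L_{\mathcal A}$-embedding, into a direct power of $\mathcal B$; 4. $\mathcal C$ is $\mathcal A$-separated by $\mathcal B$: for all $c_1\ne c_2$ in $C$ there is an $L_{\mathcal A}$-homomorphism $h\colon\mathcal C\to\mathcal B$ with $h(c_1)\neq h(c_2)$; 5. $\mathcal C$ is isomorphic to a subdirect product of finitely many $\mathcal A$-limit algebras over $\mathcal B$; 6. $\mathcal C$ is isomorphic to the algebra defined by a complete atomic type in the theory $\mathrm{Th}_{\mathrm{qi},\mathcal A}(\mathcal B)$: for some finite set $X$ of variables there is a maximal set $p$ of equations and negated equations of $L_{\mathcal A}$ in $X$ that is realized in some model of $\mathrm{Th}_{\mathrm{qi},\mathcal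 A}(\mathcal B)$, such that $\mathcal C\cong \mathcal T_{L_{\mathcal A}}(X)/\theta_p$, where $\mathcal T_{L_{\mathcal A}}(X)$ is the term algebra and $t\mathrel{\theta_p}s$ iff the equation $t=s$ belongs to $p$; 7. $\mathcal C$ is isomorphic to the coordinate algebra of an algebraic set over $\mathcal B$ with coefficients in $\mathcal A$: $\mathcal C\cong\Gamma(Y)=\mathcal T_{L_{\mathcal A}}(x_1,\dots,x_n)/\theta_{\mathrm{Rad}(Y)}$ for some $n$ and some $Y=V_{\mathcal B}(S)\subseteq B^n$, $S$ a system of $L_{\mathcal A}$-equations in $x_1,\dots,x_n$, where $t\mathrel{\theta_{\mathrm{Rad}(Y)}}s$ iff $t$ and $s$ take equal values at all points of $Y$. Here an $\mathcal A$-limit algebra over $\mathcal B$ is the limit of a direct system of diagram formulas of $L_{\mathcal A}$ realized in $\mathcal B$. A diagram formula $\varphi(X)$ in a finite set $X$ of variables is the diagram of a finite partial algebra with universe $X$: the conjunction of $x\ne y$ for all distinct $x,y\in X$ and of finitely many formulas $F(x_1,\dots,x_n)=y$ ($x_i,y\in X$, $F$ a function symbol or constant), with at most one $y$ for each left-hand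 side. A direct system consists of diagram formulas $\varphi_i(X_i)$, $i\in I$, over a non-empty directed partially ordered set $I$, and maps $\gamma_{ij}\colon X_i\to X_j$ ($i\le j$) with $\gamma_{ii}=\mathrm{id}$, $\gamma_{jk}\gamma_{ij}=\gamma_{ik}$, which carry conjuncts of $\varphi_i$ to conjuncts of $\varphi_j$, such that for all $i$, every $n$-ary $F$ and all $x_1,\dots,x_n\in X_i$ there are $j\ge i$ and $y\in X_j$ for which $F(\gamma_{ij}(x_1),\dots,\gamma_{ij}(x_n))=y$ is a conjunct of $\varphi_j$. It is realized in $\mathcal B$ if every $\varphi_i$ is satisfied by some tuple of elements of $B$. Its limit is the direct limit of the sets $X_i$ with the operations given by the conjuncts of the $\varphi_i$. -/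

import Mathlib

open FirstOrder FirstOrder.Language

universe u v w a

namespace UnivAlgGeom

section Basic

/-- An equation `t₁ = t₂` in the variables `x₁, …, xₙ`. In a language without relation symbols
these are exactly the atomic formulas. -/
abbrev Equation (L : FirstOrder.Language.{u, v}) (n : ℕ) : Type u :=
  L.Term (Fin n) × L.Term (Fin n)

/-- The direct product of a family of structures (the one-point algebra for an empty family, when
there are no relation symbols). -/
instance productStructure (L : FirstOrder.Language.{u, v}) {I : Type a} (M : I → Type w)
    [∀ i, L.Structure (M i)] : L.Structure (∀ i, M i) where
  funMap f x := fun i => Structure.funMap f fun k => x k i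
  RelMap r x := ∀ i, Structure.RelMap r fun k => x k i

/-- The absolutely free algebra (term algebra) with basis `α`. -/
instance termStructure (L : FirstOrder.Language.{u, v}) (α : Type a) : L.Structure (L.Term α) where
  funMap f ts := Term.func f ts
  RelMap _ _ := False

/-- Congruences of the absolutely free algebra with basis `α`. -/
structure TermCongruence (L : FirstOrder.Language.{u, v}) (α : Type a) extends Setoid (L.Term α) where
  func_congr : ∀ {n : ℕ} (f : L.Functions n) (x y : Fin n → L.Term α),
    (∀ i, toSetoid (x i) (y i)) → toSetoid (Term.func f x) (Term.func f y)

instance TermCongruence.prestructure {L : FirstOrder.Language.{u, v}} {α : Type a}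
    (θ : TermCongruence L α) : L.Prestructure θ.toSetoid where
  toStructure := termStructure L α
  fun_equiv := fun {_} {f} x y h => θ.func_congr f x y h
  rel_equiv := fun _ _ _ => rfl

/-- The quotient of the absolutely free algebra by a congruence, with the quotient structure. -/
abbrev TermCongruence.Quot {L : FirstOrder.Language.{u, v}} {α : Type a} (θ : TermCongruence L α) :
    Type (max u a) :=
  Quotient θ.toSetoid

end Basic

section AlgebraicSets

/-- The algebraic set `V_B(S) ⊆ Bⁿ` of all roots of the system `S`. -/
def zeroLocus {L : FirstOrder.Language.{u, v}} (B : Type w) [L.Structure B] {n : ℕ}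
    (S : Set (Equation L n)) : Set (Fin n → B) :=
  {p | ∀ e ∈ S, e.1.realize p = e.2.realize p}

/-- The radical `Rad(Y)` of a set `Y ⊆ Bⁿ`. -/
def radical (L : FirstOrder.Language.{u, v}) {B : Type w} [L.Structure B] {n : ℕ}
    (Y : Set (Fin n → B)) : Set (Equation L n) :=
  {e | ∀ p ∈ Y, e.1.realize p = e.2.realize p}

/-- The congruence `θ_{Rad(Y)}`. -/
def radicalCongruence (L : FirstOrder.Language.{u, v}) {B : Type w} [L.Structure B] {n : ℕ}
    (Y : Set (Fin n → B)) : TermCongruence L (Fin n) where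
  r t s := (t, s) ∈ radical L Y
  iseqv :=
    { refl := fun _ _ _ => rfl
      symm := fun h p hp => (h p hp).symm
      trans := fun h k p hp => (h p hp).trans (k p hp) }
  func_congr f x y h p hp := by
    change Structure.funMap f (fun i => (x i).realize p) =
      Structure.funMap f (fun i => (y i).realize p)
    exact congrArg _ (funext fun i => h i p hp)

/-- The coordinate algebra `Γ(Y)`. -/
abbrev CoordinateAlgebra (L : FirstOrder.Language.{u, v}) {B : Type w} [L.Structure B] {n : ℕ}
    (Y : Set (Fin n → B)) : Type u :=
  (radicalCongruence L Y).Quot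

/-- `C` is (up to isomorphism) the coordinate algebra of an algebraic set over `B`. -/
def IsCoordinateAlgebra (L : FirstOrder.Language.{u, v}) (B C : Type w) [L.Structure B] [L.Structure C] :
    Prop :=
  ∃ (n : ℕ) (S : Set (Equation L n)), Nonempty (C ≃[L] CoordinateAlgebra L (zeroLocus B S))

/-- Every system of equations in finitely many variables is equivalent over `B` to one of its
finite subsystems. -/
def EquationallyNoetherian (L : FirstOrder.Language.{u, v}) (B : Type w) [L.Structure B] : Prop :=
  ∀ n : ℕ, 0 < n → ∀ S : Set (Equation L n),
    ∃ S₀ : Set (Equation L n), S₀ ⊆ S ∧ S₀.Finite ∧ zeroLocus B S = zeroLocus B S₀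

end AlgebraicSets

section Classes

/-- The quasi-identity `∀ x₁ … xₙ (⋀ₖ premₖ → concl)`. -/
noncomputable def quasiIdentity {L : FirstOrder.Language.{u, v}} {n m : ℕ} (prem : Fin m → Equation L n)
    (concl : Equation L n) : L.Sentence :=
  Formula.iAlls (α := Empty) (Fin n)
    (Formula.relabel Sum.inr
      ((Formula.iInf fun k => Term.equal (prem k).1 (prem k).2).imp
        (Term.equal concl.1 concl.2)))

/-- `Th_qi(B)`: all quasi-identities that are true in `B`. -/
def quasiTheory (L : FirstOrder.Language.{u, v}) (B : Type w) [L.Structure B] : L.Theory :=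
  {φ | (∃ (n m : ℕ) (prem : Fin m → Equation L n) (concl : Equation L n),
      φ = quasiIdentity prem concl) ∧ B ⊨ φ}

/-- `C ∈ Qvar(B) = Mod(Th_qi(B))`. -/
def MemQvar (L : FirstOrder.Language.{u, v}) (B C : Type w) [L.Structure B] [L.Structure C] : Prop :=
  C ⊨ quasiTheory L B

/-- A prevariety: a class of algebras closed under isomorphic copies, subalgebras and direct
products (the product of the empty family included). -/
structure IsPrevariety (L : FirstOrder.Language.{u, v})
    (K : Set (CategoryTheory.Bundled.{w} L.Structure)) : Prop where
  iso : ∀ M N : CategoryTheory.Bundled.{w} L.Structure, M ∈ K → Nonempty (M ≃[L] N) → N ∈ K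
  sub : ∀ M : CategoryTheory.Bundled.{w} L.Structure, M ∈ K → ∀ S : L.Substructure M,
    CategoryTheory.Bundled.of (c := L.Structure) S ∈ K
  prod : ∀ (I : Type w) (M : I → CategoryTheory.Bundled.{w} L.Structure), (∀ i, M i ∈ K) →
    CategoryTheory.Bundled.of (c := L.Structure) (∀ i, M i) ∈ K

/-- `C ∈ Pvar(B)`: `C` lies in the least prevariety containing `B`. -/
def MemPvar (L : FirstOrder.Language.{u, v}) (B C : Type w) [L.Structure B] [L.Structure C] : Prop :=
  ∀ K : Set (CategoryTheory.Bundled.{w} L.Structure), IsPrevariety L K →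
    CategoryTheory.Bundled.of (c := L.Structure) B ∈ K →
      CategoryTheory.Bundled.of (c := L.Structure) C ∈ K

/-- `C` embeds into a direct power of `B`. -/
def EmbedsInPower (L : FirstOrder.Language.{u, v}) (B C : Type w) [L.Structure B] [L.Structure C] : Prop :=
  ∃ I : Type w, Nonempty (C ↪[L] (I → B))

/-- `C` is separated by `B`. -/
def IsSeparatedBy (L : FirstOrder.Language.{u, v}) (B C : Type w) [L.Structure B] [L.Structure C] : Prop :=
  ∀ c₁ c₂ : C, c₁ ≠ c₂ → ∃ h : C →[L] B, h c₁ ≠ h c₂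

end Classes

section LimitAlgebras

/-- A conjunct `F(x₁, …, xₙ) = y` of a diagram formula in the variables `X`; constants of the
language are the case `n = 0`. -/
structure Conjunct (L : FirstOrder.Language.{u, v}) (X : Type w) where
  arity : ℕ
  symbol : L.Functions arity
  arg : Fin arity → X
  val : X

/-- Substitution of variables in a conjunct. -/
def Conjunct.map {L : FirstOrder.Language.{u, v}} {X : Type w} {Y : Type a} (g : X → Y)
    (c : Conjunct L X) : Conjunct L Y :=
  ⟨c.arity, c.symbol, g ∘ c.arg, g c.val⟩

/-- The conjunct is true under the interpretation `g` of the variables. -/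
def Conjunct.Holds {L : FirstOrder.Language.{u, v}} {X : Type w} {M : Type a} [L.Structure M] (g : X → M)
    (c : Conjunct L X) : Prop :=
  Structure.funMap c.symbol (g ∘ c.arg) = g c.val

/-- A diagram formula in the finite set of variables `X`, that is, the diagram of a finite partial
algebra with universe `X`: the conjunction of `x ≠ y` for all distinct `x, y` in `X` and of finitely
many conjuncts `F(x₁, …, xₙ) = y`, with at most one `y` for each left-hand side. -/
structure DiagramFormula (L : FirstOrder.Language.{u, v}) (X : Type w) where
  conj : Set (Conjunct L X)
  finite : conj.Finite
  functional : ∀ {n : ℕ} (F : L.Functions n) (x : Fin n → X) (y z : X),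
    (⟨n, F, x, y⟩ : Conjunct L X) ∈ conj → (⟨n, F, x, z⟩ : Conjunct L X) ∈ conj → y = z

/-- The diagram formula is realized in `M` by some tuple; injectivity is the truth of the conjuncts
`x ≠ y`. -/
def DiagramFormula.IsRealizedIn {L : FirstOrder.Language.{u, v}} {X : Type w} (φ : DiagramFormula L X)
    (M : Type a) [L.Structure M] : Prop :=
  ∃ g : X → M, Function.Injective g ∧ ∀ c ∈ φ.conj, c.Holds g

/-- A direct system of diagram formulas: formulas `φ i` in finite sets of variables `X i`,
and a directed system of maps `γ` of variables carrying conjuncts of `φ i` (the inequalities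
included, so that `γ` is injective) to conjuncts of `φ j`, such that every `F(x₁, …, xₙ)` gets a value at some later stage. -/
structure DiagramSystem (L : FirstOrder.Language.{u, v}) (I : Type a) [PartialOrder I] where
  X : I → Type w
  finite : ∀ i, Finite (X i)
  φ : ∀ i, DiagramFormula L (X i)
  γ : ∀ i j : I, i ≤ j → X i ↪ X j
  directed : DirectedSystem X (γ · · ·)
  map_conj : ∀ (i j : I) (h : i ≤ j), ∀ c ∈ (φ i).conj, c.map (γ i j h) ∈ (φ j).conj
  complete : ∀ (i : I) {n : ℕ} (F : L.Functions n) (x : Fin n → X i),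
    ∃ (j : I) (h : i ≤ j) (y : X j), (⟨n, F, γ i j h ∘ x, y⟩ : Conjunct L (X j)) ∈ (φ j).conj

namespace DiagramSystem

variable {L : FirstOrder.Language.{u, v}} {I : Type a} [PartialOrder I] [IsDirectedOrder I]

instance directedSystem (D : DiagramSystem.{u, v, w, a} L I) : DirectedSystem D.X (D.γ · · ·) :=
  D.directed

/-- The universe of the limit algebra: the direct limit of the sets of variables. -/
def Limit (D : DiagramSystem.{u, v, w, a} L I) : Type (max a w) :=
  _root_.DirectLimit D.X D.γ

/-- The element of the limit represented by a variable. -/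
def incl (D : DiagramSystem.{u, v, w, a} L I) (i : I) (x : D.X i) : D.Limit :=
  (⟦⟨i, x⟩⟧ : _root_.DirectLimit D.X D.γ)

/-- `F(z₁, …, zₙ) = y` is witnessed by a conjunct of one of the formulas. -/
def IsValue (D : DiagramSystem.{u, v, w, a} L I) {n : ℕ} (F : L.Functions n)
    (z : Fin n → D.Limit) (y : D.Limit) : Prop :=
  ∃ (i : I) (x : Fin n → D.X i) (y₀ : D.X i), (∀ k, z k = D.incl i (x k)) ∧ y = D.incl i y₀ ∧
    (⟨n, F, x, y₀⟩ : Conjunct L (D.X i)) ∈ (D.φ i).conj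

theorem incl_γ (D : DiagramSystem.{u, v, w, a} L I) {i j : I} (h : i ≤ j) (x : D.X i) :
    D.incl j (D.γ i j h x) = D.incl i x :=
  _root_.DirectLimit.mk_apply (f := D.γ) i j x h

theorem incl_injective (D : DiagramSystem.{u, v, w, a} L I) (i : I) :
    Function.Injective (D.incl i) := by
  intro x y h
  obtain ⟨k, hx, hy, e⟩ := Quotient.exact h
  exact (D.γ i k hx).injective e

theorem exists_isValue [Nonempty I] (D : DiagramSystem.{u, v, w, a} L I) {n : ℕ}
    (F : L.Functions n) (z : Fin n → D.Limit) : ∃ y, D.IsValue F z y := by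
  have hz : ∀ k, ∃ (i : I) (x : D.X i), z k = D.incl i x :=
    fun k => _root_.DirectLimit.exists_eq_mk D.γ (z k)
  choose i x hx using hz
  obtain ⟨m, hm⟩ := Finite.bddAbove_range i
  have hle : ∀ k, i k ≤ m := fun k => hm ⟨k, rfl⟩
  obtain ⟨j, h, y, hy⟩ := D.complete m F fun k => D.γ _ _ (hle k) (x k)
  refine ⟨D.incl j y, j, _, y, fun k => ?_, rfl, hy⟩
  rw [hx k, Function.comp_apply, incl_γ, incl_γ]

theorem isValue_unique (D : DiagramSystem.{u, v, w, a} L I) {n : ℕ} (F : L.Functions n)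
    (z : Fin n → D.Limit) (y y' : D.Limit) (h : D.IsValue F z y) (h' : D.IsValue F z y') :
    y = y' := by
  obtain ⟨i, x, y₀, hz, rfl, hc⟩ := h
  obtain ⟨i', x', y₀', hz', rfl, hc'⟩ := h'
  obtain ⟨k, hk, hk'⟩ := exists_ge_ge i i'
  have e : D.γ i k hk ∘ x = D.γ i' k hk' ∘ x' := by
    funext t
    apply D.incl_injective k
    rw [Function.comp_apply, Function.comp_apply, incl_γ, incl_γ, ← hz, ← hz']
  have c := D.map_conj i k hk _ hc
  have c' := D.map_conj i' k hk' _ hc'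
  simp only [Conjunct.map] at c c'
  rw [e] at c
  rw [← D.incl_γ hk, ← D.incl_γ hk', (D.φ k).functional F _ _ _ c c']

/-- The limit algebra of the system: `F(z₁, …, zₙ)` is the unique value given by the conjuncts. -/
noncomputable instance limitStructure [Nonempty I] (D : DiagramSystem.{u, v, w, a} L I) :
    L.Structure D.Limit where
  funMap F z := (D.exists_isValue F z).choose
  RelMap _ _ := False

end DiagramSystem

/-- `C` is (up to isomorphism) a limit algebra over `B`: the limit of a direct system of diagram
formulas each of which is realized in `B`. -/
def IsLimitAlgebra (L : FirstOrder.Language.{u, v}) (B C : Type w) [L.Structure B] [L.Structure C] : Prop :=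
  ∃ (I : Type (max u w)) (_ : PartialOrder I) (_ : IsDirectedOrder I) (_ : Nonempty I)
    (D : DiagramSystem.{u, v, w, max u w} L I),
    (∀ i, (D.φ i).IsRealizedIn B) ∧ Nonempty (C ≃[L] D.Limit)

/-- `C` is (up to isomorphism) a subdirect product of finitely many limit algebras over `B`. -/
def IsFiniteSubdirectProductOfLimits (L : FirstOrder.Language.{u, v}) (B C : Type w) [L.Structure B]
    [L.Structure C] : Prop :=
  ∃ (k : ℕ) (D : Fin k → CategoryTheory.Bundled.{w} L.Structure),
    (∀ i, IsLimitAlgebra L B (D i)) ∧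
      ∃ e : C ↪[L] (∀ i, D i), ∀ i, Function.Surjective fun c => e c i

end LimitAlgebras

section AtomicTypes

/-- `p` is an atomic type in `x₁, …, xₙ` relative to the theory `T`: a set of equations and
negations of equations which is consistent with `T`, i.e. realized in some model of `T`. -/
def IsAtomicType {L : FirstOrder.Language.{u, v}} (T : L.Theory) {n : ℕ} (p : Set (L.Formula (Fin n))) :
    Prop :=
  (∀ φ ∈ p, ∃ t s : L.Term (Fin n), φ = Term.equal t s ∨ φ = (Term.equal t s).not) ∧
    ∃ (M : Theory.ModelType.{u, v, max u v} T) (x : Fin n → M), ∀ φ ∈ p, φ.Realize x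

/-- A complete atomic type is a maximal one. -/
def IsCompleteAtomicType {L : FirstOrder.Language.{u, v}} (T : L.Theory) {n : ℕ}
    (p : Set (L.Formula (Fin n))) : Prop :=
  Maximal (IsAtomicType T) p

theorem IsCompleteAtomicType.exists_realization {L : FirstOrder.Language.{u, v}} {T : L.Theory} {n : ℕ}
    {p : Set (L.Formula (Fin n))} (hp : IsCompleteAtomicType T p) :
    ∃ (M : Theory.ModelType.{u, v, max u v} T) (x : Fin n → M),
      ∀ t s : L.Term (Fin n), Term.equal t s ∈ p ↔ t.realize x = s.realize x := by
  obtain ⟨hlit, M, x, hx⟩ := hp.prop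
  refine ⟨M, x, fun t s => ⟨fun h => Formula.realize_equal.1 (hx _ h), fun h => ?_⟩⟩
  have hq : IsAtomicType T (insert (Term.equal t s) p) := by
    refine ⟨?_, M, x, ?_⟩
    · rintro φ (rfl | hφ)
      · exact ⟨t, s, Or.inl rfl⟩
      · exact hlit φ hφ
    · rintro φ (rfl | hφ)
      · exact Formula.realize_equal.2 h
      · exact hx φ hφ
  exact hp.le_of_ge hq (Set.subset_insert _ _) (Set.mem_insert _ _)

/-- The congruence `t ∼ s ↔ (t = s) ∈ p` of a complete atomic type. -/
def typeCongruence {L : FirstOrder.Language.{u, v}} {T : L.Theory} {n : ℕ} {p : Set (L.Formula (Fin n))}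
    (hp : IsCompleteAtomicType T p) : TermCongruence L (Fin n) where
  r t s := Term.equal t s ∈ p
  iseqv := by
    obtain ⟨M, x, h⟩ := hp.exists_realization
    simp only [h]
    exact ⟨fun _ => rfl, fun h => h.symm, fun h k => h.trans k⟩
  func_congr f y z e := by
    obtain ⟨M, x, h⟩ := hp.exists_realization
    refine (h _ _).2 ?_
    change Structure.funMap f (fun i => (y i).realize x) =
      Structure.funMap f (fun i => (z i).realize x)
    exact congrArg _ (funext fun i => (h _ _).1 (e i))

/-- `C` is (up to isomorphism) the algebra defined by a complete atomic type in the theory `T`. -/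
def IsDefinedByCompleteAtomicType {L : FirstOrder.Language.{u, v}} (T : L.Theory) (C : Type w)
    [L.Structure C] : Prop :=
  ∃ (n : ℕ) (p : Set (L.Formula (Fin n))) (hp : IsCompleteAtomicType T p),
    Nonempty (C ≃[L] (typeCongruence hp).Quot)

end AtomicTypes

section Coefficients

/-- The diagram `Diag(A)` in the language `L_A = L ∪ {c_a | a ∈ A}`: all atomic sentences and
negations of atomic sentences that are true in `A`. -/
def diagram (L : FirstOrder.Language.{u, v}) (A : Type w) [L.Structure A] : L[[A]].Theory :=
  {φ | (∃ t s : L[[A]].Term Empty, φ = Term.equal t s ∨ φ = (Term.equal t s).not) ∧ A ⊨ φ}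

/-- `B` is an `A`-algebra: an algebra in the language `L_A` which satisfies `Diag(A)`. -/
def IsAlgebraOver (L : FirstOrder.Language.{u, v}) (A B : Type w) [L.Structure A] [L[[A]].Structure B] :
    Prop :=
  B ⊨ diagram L A

end Coefficients

end UnivAlgGeom

/-! Fix a finite generating tuple `c` of `C`. Homomorphisms `C → B` are the points of `Bⁿ`
satisfying every equation true at `c`, and the pivot of the equivalences is separation by `B`. The
Noetherian condition replaces the relations of `c` by finitely many; if `t = s` held at all their
solutions in `B` but failed at `c`, a quasi-identity true in `B` would fail in `C`
(`MemQvar.isSeparatedBy`). Powers, prevarieties and coordinate algebras rephrase separation, while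
complete atomic types describe finitely generated subalgebras of models of the quasi-identities.

For limit algebras, the Noetherian condition gives the descending chain condition on sets of
homomorphisms cut out by conditions `h x = h y`. So the set of all homomorphisms `C → B` is a finite
union of irreducible pieces `Z` (`exists_irreducible_decomposition`). Irreducibility yields, for
each finite part of the image of `C` in the power `Z → B`, one coordinate injective on it; hence the
image is the limit of its finite diagrams. Conversely, an instance of a quasi-identity in a limit is
decided at a single stage, realized injectively in `B`. -/

namespace UnivAlgGeom

/-! ### Finitely generated algebras and their presentations. -/

section Generators

variable {L : FirstOrder.Language.{u, v}}

/-- The tuple `c` generates the algebra. -/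
def Generates (L : FirstOrder.Language.{u, v}) {C : Type*} [L.Structure C] {n : ℕ}
    (c : Fin n → C) : Prop :=
  ∀ x : C, ∃ t : L.Term (Fin n), t.realize c = x

theorem exists_generates {C : Type*} [L.Structure C] [Nonempty C] (h : Structure.FG L C) :
    ∃ (n : ℕ) (c : Fin n → C), 0 < n ∧ Generates L c := by
  obtain ⟨n, c, hc⟩ := Substructure.fg_iff_exists_fin_generating_family.1 (Structure.fg_def.1 h)
  obtain ⟨x₀⟩ := ‹Nonempty C›
  -- The redundant generator `x₀` forces a positive number of variables, the only case covered by
  -- `EquationallyNoetherian`.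
  refine ⟨n + 1, Fin.cons x₀ c, n.succ_pos, fun x => ?_⟩
  have hx : x ∈ Substructure.closure L (Set.range c) := hc ▸ Substructure.mem_top x
  obtain ⟨t, rfl⟩ := Substructure.mem_closure_iff_exists_term.1 hx
  have hi : ∀ y : Set.range c, ∃ i, c i = y := fun y => y.2
  choose i hi using hi
  refine ⟨t.relabel fun y => (i y).succ, ?_⟩
  rw [Term.realize_relabel]
  congr 1
  funext y
  simp [hi]

/-- Choose a term for each element and evaluate it at `p`; by `h` the choice does not matter, whence
compatibility with the operations. -/
theorem Generates.exists_hom [L.IsAlgebraic] {C M : Type*} [L.Structure C] [L.Structure M] {n : ℕ}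
    {c : Fin n → C} (hc : Generates L c) (p : Fin n → M)
    (h : ∀ t s : L.Term (Fin n), t.realize c = s.realize c → t.realize p = s.realize p) :
    ∃ g : C →[L] M, ∀ t : L.Term (Fin n), g (t.realize c) = t.realize p := by
  choose τ hτ using hc
  refine ⟨⟨fun x => (τ x).realize p, fun {k} f x => ?_, fun r => isEmptyElim r⟩,
    fun t => h _ _ (hτ _)⟩
  refine h (τ (Structure.funMap f x)) (Term.func f fun i => τ (x i)) ?_
  rw [hτ, Term.realize_func]
  simp only [hτ]

theorem Generates.nonempty_equiv [L.IsAlgebraic] {C D : Type*} [L.Structure C] [L.Structure D]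
    {n : ℕ} {c : Fin n → C} {d : Fin n → D} (hc : Generates L c) (hd : Generates L d)
    (h : ∀ t s : L.Term (Fin n), t.realize c = s.realize c ↔ t.realize d = s.realize d) :
    Nonempty (C ≃[L] D) := by
  obtain ⟨g, hg⟩ := hc.exists_hom d fun t s => (h t s).1
  have hbij : Function.Bijective g := by
    refine ⟨fun x y e => ?_, fun y => ?_⟩
    · obtain ⟨t, rfl⟩ := hc x
      obtain ⟨s, rfl⟩ := hc y
      rw [hg, hg] at e
      exact (h t s).2 e
    · obtain ⟨t, rfl⟩ := hd y
      exact ⟨_, hg t⟩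
  exact ⟨⟨Equiv.ofBijective g hbij, fun f x => g.map_fun f x, fun r => isEmptyElim r⟩⟩

theorem TermCongruence.realize_mk {n : ℕ} (θ : TermCongruence L (Fin n)) (t : L.Term (Fin n)) :
    t.realize (fun i => (⟦Term.var i⟧ : θ.Quot)) = ⟦t⟧ := by
  induction t with
  | var => rfl
  | func f ts ih =>
    rw [Term.realize_func]
    simp only [ih]
    exact funMap_quotient_mk' θ.toSetoid f ts

theorem TermCongruence.generates {n : ℕ} (θ : TermCongruence L (Fin n)) :
    Generates L (fun i => (⟦Term.var i⟧ : θ.Quot)) := fun x =>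
  Quotient.inductionOn x fun t => ⟨t, θ.realize_mk t⟩

theorem TermCongruence.realize_eq_iff {n : ℕ} (θ : TermCongruence L (Fin n))
    (t s : L.Term (Fin n)) :
    t.realize (fun i => (⟦Term.var i⟧ : θ.Quot)) = s.realize (fun i => (⟦Term.var i⟧ : θ.Quot)) ↔
      θ.toSetoid t s := by
  rw [θ.realize_mk, θ.realize_mk]
  exact Quotient.eq

end Generators

/-! ### Models of the quasi-identities of `B`. -/

section QuasiIdentities

variable {L : FirstOrder.Language.{u, v}}

theorem realize_quasiIdentity {M : Type*} [L.Structure M] {n m : ℕ} (prem : Fin m → Equation L n)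
    (concl : Equation L n) :
    M ⊨ quasiIdentity prem concl ↔ ∀ x : Fin n → M,
      (∀ k, (prem k).1.realize x = (prem k).2.realize x) →
        concl.1.realize x = concl.2.realize x := by
  rw [quasiIdentity, Sentence.Realize, Formula.realize_iAlls]
  refine forall_congr' fun x => ?_
  rw [Formula.realize_relabel, Formula.realize_imp, Formula.realize_equal, Formula.realize_iInf]
  simp only [Formula.realize_equal]
  rfl

/-- Models of `Th_qi(B)`, in terms of solutions of equations. -/
theorem model_quasiTheory_iff {B C : Type*} [L.Structure B] [L.Structure C] :
    C ⊨ quasiTheory L B ↔ ∀ (n m : ℕ) (prem : Fin m → Equation L n) (concl : Equation L n),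
      (∀ x : Fin n → B, (∀ k, (prem k).1.realize x = (prem k).2.realize x) →
        concl.1.realize x = concl.2.realize x) →
      ∀ x : Fin n → C, (∀ k, (prem k).1.realize x = (prem k).2.realize x) →
        concl.1.realize x = concl.2.realize x := by
  rw [Theory.model_iff]
  constructor
  · intro h n m prem concl hB
    exact (realize_quasiIdentity prem concl).1
      (h _ ⟨⟨n, m, prem, concl, rfl⟩, (realize_quasiIdentity prem concl).2 hB⟩)
  · rintro h _ ⟨⟨n, m, prem, concl, rfl⟩, hB⟩
    exact (realize_quasiIdentity prem concl).2
      (h n m prem concl ((realize_quasiIdentity prem concl).1 hB))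

theorem model_quasiTheory_self (B : Type*) [L.Structure B] : B ⊨ quasiTheory L B :=
  model_quasiTheory_iff.2 fun _ _ _ _ h => h

theorem memQvar_iff_subset {B C : Type w} [L.Structure B] [L.Structure C] :
    MemQvar L B C ↔ quasiTheory L B ⊆ quasiTheory L C := by
  rw [MemQvar, Theory.model_iff]
  exact ⟨fun h φ hφ => ⟨hφ.1, h φ hφ⟩, fun h φ hφ => (h hφ).2⟩

/-- An algebra separated by homomorphisms to models of `Th_qi(B)` is a model of `Th_qi(B)`. -/
theorem model_quasiTheory_of_separated {B C : Type*} [L.Structure B] [L.Structure C]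
    (h : ∀ c₁ c₂ : C, c₁ ≠ c₂ → ∃ (M : Type a) (_ : L.Structure M) (g : C →[L] M),
      M ⊨ quasiTheory L B ∧ g c₁ ≠ g c₂) : C ⊨ quasiTheory L B := by
  refine model_quasiTheory_iff.2 fun n m prem concl hB x hx => ?_
  by_contra hne
  obtain ⟨M, _, g, hM, hg⟩ := h _ _ hne
  refine hg ?_
  rw [← HomClass.realize_term, ← HomClass.realize_term]
  refine model_quasiTheory_iff.1 hM n m prem concl hB (g ∘ x) fun k => ?_
  rw [HomClass.realize_term, HomClass.realize_term, hx k]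

theorem model_quasiTheory_of_injective {B C M : Type*} [L.Structure B] [L.Structure C]
    [L.Structure M] [hM : M ⊨ quasiTheory L B] (g : C →[L] M) (hg : Function.Injective g) :
    C ⊨ quasiTheory L B :=
  model_quasiTheory_of_separated fun _ _ hne => ⟨M, _, g, hM, hg.ne hne⟩

theorem IsSeparatedBy.memQvar {B C : Type w} [L.Structure B] [L.Structure C]
    (h : IsSeparatedBy L B C) : MemQvar L B C :=
  model_quasiTheory_of_separated fun c₁ c₂ hne =>
    (h c₁ c₂ hne).elim fun g hg => ⟨B, _, g, model_quasiTheory_self B, hg⟩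

end QuasiIdentities

/-! ### Separation, direct powers and prevarieties. -/

section Separation

variable {L : FirstOrder.Language.{u, v}}

/-- The homomorphism to a direct product given by its components. -/
def homPi [L.IsAlgebraic] {I : Type*} {C : Type*} {M : I → Type*} [L.Structure C]
    [∀ i, L.Structure (M i)] (g : ∀ i, C →[L] M i) : C →[L] (∀ i, M i) where
  toFun c i := g i c
  map_fun' f x := funext fun i => (g i).map_fun f x
  map_rel' r := isEmptyElim r

/-- Projection of a direct product. -/
def projHom [L.IsAlgebraic] {I : Type*} {M : I → Type*} [∀ i, L.Structure (M i)] (i : I) :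
    (∀ i, M i) →[L] M i where
  toFun x := x i
  map_fun' _ _ := rfl
  map_rel' r := isEmptyElim r

theorem IsSeparatedBy.embedsInPower [L.IsAlgebraic] {B C : Type w} [L.Structure B] [L.Structure C]
    (h : IsSeparatedBy L B C) : EmbedsInPower L B C := by
  -- The exponent is the set of all homomorphisms, and the embedding is evaluation.
  refine ⟨C →[L] B, ⟨Embedding.ofInjective (f := homPi fun g => g) fun x y e => ?_⟩⟩
  by_contra hne
  obtain ⟨g, hg⟩ := h x y hne
  exact hg (congrFun e g)

theorem EmbedsInPower.memPvar {B C : Type w} [L.Structure B] [L.Structure C]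
    (h : EmbedsInPower L B C) : MemPvar L B C := by
  obtain ⟨I, ⟨e⟩⟩ := h
  intro K hK hB
  exact hK.iso _ (.of C) (hK.sub _ (hK.prod I (fun _ => .of B) fun _ => hB) e.toHom.range)
    ⟨e.equivRange.symm⟩

theorem IsSeparatedBy.of_injective {B C D : Type w} [L.Structure B] [L.Structure C] [L.Structure D]
    (h : IsSeparatedBy L B D) (g : C →[L] D) (hg : Function.Injective g) : IsSeparatedBy L B C :=
  fun _ _ hne => (h _ _ (hg.ne hne)).elim fun k hk => ⟨k.comp g, hk⟩

/-- As this class also contains `B`, minimality puts the whole prevariety generated by `B` inside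
it. -/
theorem isPrevariety_isSeparatedBy [L.IsAlgebraic] (B : Type w) [L.Structure B] :
    IsPrevariety L {M : CategoryTheory.Bundled.{w} L.Structure | IsSeparatedBy L B M} where
  iso _ _ hM := fun ⟨e⟩ => IsSeparatedBy.of_injective hM e.symm.toHom e.symm.injective
  sub _ hM S := IsSeparatedBy.of_injective hM S.subtype.toHom S.subtype.injective
  prod _ _ hM := fun _ _ hne =>
    (Function.ne_iff.1 hne).elim fun i hi =>
      (hM i _ _ hi).elim fun k hk => ⟨k.comp (projHom i), hk⟩

theorem MemPvar.isSeparatedBy [L.IsAlgebraic] {B C : Type w} [L.Structure B] [L.Structure C]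
    (h : MemPvar L B C) : IsSeparatedBy L B C :=
  h _ (isPrevariety_isSeparatedBy B) fun _ _ hne => ⟨Hom.id L B, hne⟩

end Separation

/-! ### Points of algebraic sets as homomorphisms. -/

section CoordinateAlgebras

variable {L : FirstOrder.Language.{u, v}} [L.IsAlgebraic] {B C : Type w} [L.Structure B]
  [L.Structure C]

/-- The equations satisfied by a tuple. -/
def relationsOf (L : FirstOrder.Language.{u, v}) {C : Type w} [L.Structure C] {n : ℕ}
    (c : Fin n → C) : Set (Equation L n) :=
  {e | e.1.realize c = e.2.realize c}

theorem MemQvar.isSeparatedBy (hN : EquationallyNoetherian L B) {n : ℕ} (hn : 0 < n)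
    {c : Fin n → C} (hc : Generates L c) (h : MemQvar L B C) : IsSeparatedBy L B C := by
  obtain ⟨K, hK, hfin, hV⟩ := hN n hn (relationsOf L c)
  intro x y hne
  obtain ⟨t, rfl⟩ := hc x
  obtain ⟨s, rfl⟩ := hc y
  obtain ⟨m, prem, hprem⟩ := hfin.fin_embedding
  -- Otherwise `K → t = s` is a genuine quasi-identity, `K` being finite; it holds in `B`, but fails
  -- at `c`.
  have hp : ∃ p : Fin n → B, p ∈ zeroLocus B K ∧ t.realize p ≠ s.realize p := by
    by_contra! hcon
    refine hne (model_quasiTheory_iff.1 h n m prem (t, s) (fun p hp => hcon p ?_) c fun k => ?_)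
    · rw [← hprem]
      rintro _ ⟨k, rfl⟩
      exact hp k
    · exact hK (hprem ▸ Set.mem_range_self k)
  obtain ⟨p, hp, hts⟩ := hp
  -- Back from `K` to all relations of `c`: only then does `p` define a homomorphism on `C`.
  rw [← hV] at hp
  obtain ⟨g, hg⟩ := hc.exists_hom p fun t s h => hp (t, s) h
  exact ⟨g, by rwa [hg, hg]⟩

/-- The algebraic set is that of all relations of `c`. Its radical contains no further equation,
because a homomorphism `g` separating two term values gives the point `g ∘ c` at which the equation
fails. -/
theorem IsSeparatedBy.isCoordinateAlgebra {n : ℕ} {c : Fin n → C} (hc : Generates L c)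
    (h : IsSeparatedBy L B C) : IsCoordinateAlgebra L B C := by
  refine ⟨n, relationsOf L c, hc.nonempty_equiv (TermCongruence.generates _) fun t s => ?_⟩
  rw [TermCongruence.realize_eq_iff]
  refine ⟨fun e p hp => hp (t, s) e, fun e => ?_⟩
  by_contra hne
  obtain ⟨g, hg⟩ := h _ _ hne
  rw [← HomClass.realize_term, ← HomClass.realize_term] at hg
  refine hg (e (g ∘ c) fun e he => ?_)
  rw [HomClass.realize_term, HomClass.realize_term, show _ = _ from he]

/-- Evaluation at a point of the algebraic set is a homomorphism, and terms inequivalent modulo the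
radical differ at some point. -/
theorem IsCoordinateAlgebra.isSeparatedBy (h : IsCoordinateAlgebra L B C) :
    IsSeparatedBy L B C := by
  obtain ⟨n, S, ⟨e⟩⟩ := h
  intro x y hne
  have hc := (radicalCongruence L (zeroLocus B S)).generates
  obtain ⟨t, ht⟩ := hc (e x)
  obtain ⟨s, hs⟩ := hc (e y)
  have hts := e.injective.ne hne
  rw [← ht, ← hs, Ne, TermCongruence.realize_eq_iff] at hts
  obtain ⟨p, hp, hts⟩ : ∃ p ∈ zeroLocus B S, t.realize p ≠ s.realize p := by
    by_contra! hcon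
    exact hts hcon
  obtain ⟨g, hg⟩ := hc.exists_hom p fun t s h =>
    (TermCongruence.realize_eq_iff _ t s).1 h p hp
  refine ⟨g.comp e.toHom, ?_⟩
  change g (e x) ≠ g (e y)
  rwa [← ht, ← hs, hg, hg]

end CoordinateAlgebras

/-! ### Complete atomic types and their realizations. -/

section AtomicTypes

variable {L : FirstOrder.Language.{u, v}} {B C : Type w} [L.Structure B] [L.Structure C]

/-- The set of all equations and negated equations satisfied by a tuple. -/
def atomicTypeOf (L : FirstOrder.Language.{u, v}) {M : Type*} [L.Structure M] {n : ℕ}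
    (x : Fin n → M) : Set (L.Formula (Fin n)) :=
  {φ | (∃ t s : L.Term (Fin n), φ = Term.equal t s ∨ φ = (Term.equal t s).not) ∧ φ.Realize x}

theorem equal_mem_atomicTypeOf {M : Type*} [L.Structure M] {n : ℕ} (x : Fin n → M)
    (t s : L.Term (Fin n)) : Term.equal t s ∈ atomicTypeOf L x ↔ t.realize x = s.realize x :=
  ⟨fun h => Formula.realize_equal.1 h.2, fun h => ⟨⟨t, s, .inl rfl⟩, Formula.realize_equal.2 h⟩⟩

/-- The type of a tuple decides every equation, so a proper extension would contain an equation
together with its negation. -/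
theorem isCompleteAtomicType_atomicTypeOf {T : L.Theory} (M : Theory.ModelType.{u, v, max u v} T)
    {n : ℕ} (x : Fin n → M) : IsCompleteAtomicType T (atomicTypeOf L x) := by
  refine ⟨⟨fun φ hφ => hφ.1, M, x, fun φ hφ => hφ.2⟩, ?_⟩
  rintro q ⟨hlit, N, y, hy⟩ hq φ hφ
  refine ⟨hlit φ hφ, ?_⟩
  by_contra hcon
  obtain ⟨t, s, rfl | rfl⟩ := hlit φ hφ
  · have h : (Term.equal t s).not ∈ q := hq ⟨⟨t, s, .inr rfl⟩, hcon⟩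
    exact hy _ h (hy _ hφ)
  · have h : Term.equal t s ∈ q := by
      refine hq ⟨⟨t, s, .inl rfl⟩, ?_⟩
      rwa [Formula.realize_not, not_not] at hcon
    exact hy _ hφ (hy _ h)

theorem MemQvar.isDefinedByCompleteAtomicType [L.IsAlgebraic] [Nonempty C] {n : ℕ} {c : Fin n → C}
    (hc : Generates L c) (h : MemQvar L B C) :
    IsDefinedByCompleteAtomicType (quasiTheory L B) C := by
  -- The radical of the single point `c` is the kernel of evaluation at `c`. The quotient by it is a
  -- copy of `C` in universe `u`, which can be lifted to the universe of models required by
  -- `IsAtomicType`.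
  have hker : ∀ t s : L.Term (Fin n), t.realize c = s.realize c ↔
      (radicalCongruence L {c}).toSetoid t s := fun t s =>
    ⟨fun e p hp => by rwa [Set.mem_singleton_iff.1 hp], fun e => e c rfl⟩
  have hd := (radicalCongruence L {c}).generates
  obtain ⟨e⟩ := hc.nonempty_equiv hd fun t s => by
    rw [TermCongruence.realize_eq_iff, hker]
  have : C ⊨ quasiTheory L B := h
  have : (radicalCongruence L {c}).Quot ⊨ quasiTheory L B :=
    model_quasiTheory_of_injective e.symm.toHom e.symm.injective
  have : Nonempty (radicalCongruence L {c}).Quot := .map e inferInstance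
  let M := (Theory.ModelType.of (quasiTheory L B) (radicalCongruence L {c}).Quot).ulift
  let f : (radicalCongruence L {c}).Quot ≃[L] M := Equiv.inducedStructureEquiv _
  refine ⟨n, _, isCompleteAtomicType_atomicTypeOf M (f ∘ fun i => ⟦Term.var i⟧),
    hc.nonempty_equiv (TermCongruence.generates _) fun t s => ?_⟩
  rw [TermCongruence.realize_eq_iff, hker, ← TermCongruence.realize_eq_iff]
  refine Iff.trans ?_ (equal_mem_atomicTypeOf _ t s).symm
  rw [HomClass.realize_term, HomClass.realize_term, f.injective.eq_iff]

/-- The algebra of the type embeds in any model realizing it, as the subalgebra generated by the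
realization. -/
theorem IsDefinedByCompleteAtomicType.memQvar [L.IsAlgebraic]
    (h : IsDefinedByCompleteAtomicType (quasiTheory L B) C) : MemQvar L B C := by
  obtain ⟨n, p, hp, ⟨e⟩⟩ := h
  obtain ⟨M, x, hx⟩ := hp.exists_realization
  have hd := (typeCongruence hp).generates
  have key : ∀ t s : L.Term (Fin n), _ ↔ _ := fun t s =>
    ((typeCongruence hp).realize_eq_iff t s).trans (hx t s)
  obtain ⟨g, hg⟩ := hd.exists_hom x fun t s => (key t s).1
  have hinj : Function.Injective g := fun a b hab => by
    obtain ⟨t, rfl⟩ := hd a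
    obtain ⟨s, rfl⟩ := hd b
    rw [hg, hg] at hab
    exact (key t s).2 hab
  exact model_quasiTheory_of_injective (hM := M.is_model) (g.comp e.toHom)
    (hinj.comp e.injective)

end AtomicTypes

/-! ### Limit algebras and finite diagrams. -/

section LimitAlgebras

namespace DiagramSystem

variable {L : FirstOrder.Language.{u, v}} {I : Type a} [PartialOrder I] [IsDirectedOrder I]
  [Nonempty I]

theorem funMap_eq_of_isValue (D : DiagramSystem.{u, v, w, a} L I) {n : ℕ} {F : L.Functions n}
    {z : Fin n → D.Limit} {y : D.Limit} (h : D.IsValue F z y) : Structure.funMap F z = y :=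
  D.isValue_unique F z _ _ (D.exists_isValue F z).choose_spec h

theorem exists_eq_incl_comp (D : DiagramSystem.{u, v, w, a} L I) {n : ℕ} (z : Fin n → D.Limit) :
    ∃ (i : I) (x : Fin n → D.X i), z = D.incl i ∘ x := by
  have hz : ∀ k, ∃ (i : I) (x : D.X i), z k = D.incl i x :=
    fun k => _root_.DirectLimit.exists_eq_mk D.γ (z k)
  choose i x hx using hz
  obtain ⟨m, hm⟩ := Finite.bddAbove_range i
  refine ⟨m, fun k => D.γ _ _ (hm ⟨k, rfl⟩) (x k), funext fun k => ?_⟩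
  rw [hx k, Function.comp_apply, incl_γ]

/-- The value of a term in the limit is attained at some stage, and from then on it is computed
correctly by every realization of the diagram formulas. -/
theorem exists_stage_realize (D : DiagramSystem.{u, v, w, a} L I) (M : Type*) [L.Structure M]
    {n : ℕ} (i : I) (x : Fin n → D.X i) (t : L.Term (Fin n)) :
    ∃ (j : I) (hij : i ≤ j) (y : D.X j), D.incl j y = t.realize (D.incl i ∘ x) ∧
      ∀ (k : I) (hjk : j ≤ k) (g : D.X k → M), (∀ c ∈ (D.φ k).conj, c.Holds g) →
        g (D.γ j k hjk y) = t.realize (g ∘ D.γ i k (hij.trans hjk) ∘ x) := by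
  induction t with
  | var l => exact ⟨i, le_rfl, x l, rfl, fun k hik g _ => rfl⟩
  | func F ts ih =>
    choose j hij y hy hg using ih
    obtain ⟨m₀, hm₀⟩ := Finite.bddAbove_range j
    -- When `F` is a constant, `m₀` bounds an empty family and need not lie above `i`.
    obtain ⟨m, h₀, him⟩ := exists_ge_ge m₀ i
    have hjm : ∀ l, j l ≤ m := fun l => (hm₀ ⟨l, rfl⟩).trans h₀
    obtain ⟨m', hm', z, hz⟩ := D.complete m F fun l => D.γ _ _ (hjm l) (y l)
    refine ⟨m', him.trans hm', z, (D.funMap_eq_of_isValue ?_).symm, fun k hk g hgk => ?_⟩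
    · refine ⟨m', _, z, fun l => ?_, rfl, hz⟩
      exact (hy l).symm.trans ((D.incl_γ (hjm l) (y l)).symm.trans (D.incl_γ hm' _).symm)
    · have hc := hgk _ (D.map_conj m' k hk _ hz)
      refine Eq.trans (Eq.symm hc) ?_
      rw [Term.realize_func]
      refine congrArg (Structure.funMap F) (funext fun l => ?_)
      rw [← hg l k ((hjm l).trans (hm'.trans hk)) g hgk]
      change g (D.γ m' k hk (D.γ m m' hm' (D.γ (j l) m (hjm l) (y l)))) = _
      rw [DirectedSystem.map_map' (f := (D.γ · · ·)), DirectedSystem.map_map' (f := (D.γ · · ·))]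

theorem model_quasiTheory_limit (D : DiagramSystem.{u, v, w, a} L I) {B : Type*} [L.Structure B]
    (h : ∀ i, (D.φ i).IsRealizedIn B) : D.Limit ⊨ quasiTheory L B := by
  refine model_quasiTheory_iff.2 fun n m prem concl hB z hz => ?_
  obtain ⟨i, x, rfl⟩ := D.exists_eq_incl_comp z
  choose j hij y hy hg using D.exists_stage_realize B i x
  obtain ⟨k₁, hk₁⟩ := Finite.bddAbove_range fun l => j (prem l).1
  obtain ⟨k₂, hk₂⟩ := Finite.bddAbove_range fun l => j (prem l).2
  obtain ⟨k₃, h₁, h₂⟩ := exists_ge_ge k₁ k₂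
  obtain ⟨k₄, h₃, h₄⟩ := exists_ge_ge (j concl.1) (j concl.2)
  obtain ⟨k, h₅, h₆⟩ := exists_ge_ge k₃ k₄
  obtain ⟨g, hinj, hgk⟩ := h k
  have hik : i ≤ k := (hij concl.1).trans (h₃.trans h₆)
  -- At stage `k` both terms have become variables; the map to the limit and the realization `g` in
  -- `B` are both injective on these, so equality means the same on either side.
  have key : ∀ t s : L.Term (Fin n), j t ≤ k → j s ≤ k →
      (t.realize (D.incl i ∘ x) = s.realize (D.incl i ∘ x) ↔
        t.realize (g ∘ D.γ i k hik ∘ x) = s.realize (g ∘ D.γ i k hik ∘ x)) := by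
    intro t s ht hs
    rw [← hy, ← hy, ← hg t k ht g hgk, ← hg s k hs g hgk, hinj.eq_iff,
      ← (D.incl_injective k).eq_iff, incl_γ, incl_γ]
  refine (key _ _ (h₃.trans h₆) (h₄.trans h₆)).2 (hB _ fun l => ?_)
  exact (key _ _ ((hk₁ ⟨l, rfl⟩).trans (h₁.trans h₅)) ((hk₂ ⟨l, rfl⟩).trans (h₂.trans h₅))).1 (hz l)

end DiagramSystem

variable {L : FirstOrder.Language.{u, v}}

theorem IsLimitAlgebra.model_quasiTheory {B C : Type w} [L.Structure B] [L.Structure C]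
    (h : IsLimitAlgebra L B C) : C ⊨ quasiTheory L B := by
  obtain ⟨I, _, _, _, D, hD, ⟨e⟩⟩ := h
  exact model_quasiTheory_of_injective (hM := D.model_quasiTheory_limit hD) e.toHom e.injective

theorem IsFiniteSubdirectProductOfLimits.memQvar [L.IsAlgebraic] {B C : Type w} [L.Structure B]
    [L.Structure C] (h : IsFiniteSubdirectProductOfLimits L B C) : MemQvar L B C := by
  obtain ⟨k, D, hD, e, -⟩ := h
  refine model_quasiTheory_of_separated fun c₁ c₂ hne => ?_
  obtain ⟨i, hi⟩ := Function.ne_iff.1 (e.injective.ne hne)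
  exact ⟨D i, _, (projHom i).comp e.toHom, (hD i).model_quasiTheory, hi⟩

theorem Conjunct.map_injective {X : Type*} {Y : Type*} {g : X → Y} (hg : Function.Injective g) :
    Function.Injective (Conjunct.map (L := L) g) := by
  rintro ⟨n, F, x, y⟩ ⟨n', F', x', y'⟩ h
  simp only [Conjunct.map, Conjunct.mk.injEq] at h
  obtain ⟨rfl, hF, hx, hy⟩ := h
  obtain rfl := eq_of_heq hF
  obtain rfl := hg.comp_left (eq_of_heq hx)
  obtain rfl := hg hy
  rfl

open scoped Classical in
/-- The direct system of all finite parts of the diagram of an algebra. -/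
noncomputable def finiteDiagrams (L : FirstOrder.Language.{u, v}) (C : Type w) [L.Structure C] :
    -- With infinitely many function symbols, a finite set of elements may support infinitely many
    -- true conjuncts; the second component keeps each formula finite.
    DiagramSystem.{u, v, w, max u w} L (Finset C × Finset (Conjunct L C)) where
  X i := i.1
  finite _ := inferInstance
  φ i :=
    { conj := {c | c.map Subtype.val ∈ i.2 ∧ c.Holds (Subtype.val : i.1 → C)}
      finite := (i.2.finite_toSet.preimage
        (Conjunct.map_injective Subtype.val_injective).injOn).subset fun _ hc => hc.1
      functional := fun _ _ _ _ hy hz => Subtype.ext (Eq.trans (Eq.symm hy.2) hz.2) }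
  γ _ _ h := ⟨fun x => ⟨x, h.1 x.2⟩, fun _ _ e => Subtype.ext (congrArg Subtype.val e :)⟩
  directed := ⟨fun _ _ => rfl, fun _ _ _ _ _ _ => rfl⟩
  map_conj _ _ h _ hc := ⟨h.2 hc.1, hc.2⟩
  complete i n F x :=
    ⟨(insert (Structure.funMap F (Subtype.val ∘ x)) i.1,
        insert ⟨n, F, Subtype.val ∘ x, Structure.funMap F (Subtype.val ∘ x)⟩ i.2),
      ⟨Finset.subset_insert _ _, Finset.subset_insert _ _⟩,
      ⟨_, Finset.mem_insert_self _ _⟩, Finset.mem_insert_self _ _, rfl⟩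

open scoped Classical in
theorem nonempty_equiv_limit_finiteDiagrams [L.IsAlgebraic] (C : Type w) [L.Structure C] :
    Nonempty (C ≃[L] (finiteDiagrams L C).Limit) := by
  let D := finiteDiagrams L C
  -- The stage `({c}, ∅)` lies below every stage that has `c` as a variable, so `ε` agrees with all
  -- the maps `incl`.
  let ε : C → D.Limit := fun c => D.incl ({c}, ∅) ⟨c, Finset.mem_singleton_self c⟩
  have hε : ∀ i (x : D.X i), ε x.1 = D.incl i x := fun i x =>
    (D.incl_γ (i := ({x.1}, ∅)) (j := i)
      ⟨Finset.singleton_subset_iff.2 x.2, Finset.empty_subset _⟩ ⟨x.1, _⟩).symm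
  have hbij : Function.Bijective ε := by
    refine ⟨fun a b e => ?_, fun z => ?_⟩
    · let x : D.X ({a, b}, ∅) := ⟨a, by simp⟩
      let y : D.X ({a, b}, ∅) := ⟨b, by simp⟩
      have e' : D.incl _ x = D.incl _ y := by rw [← hε, ← hε]; exact e
      exact congrArg Subtype.val (D.incl_injective _ e')
    · obtain ⟨i, x, rfl⟩ := _root_.DirectLimit.exists_eq_mk D.γ z
      exact ⟨x.1, hε i x⟩
  refine ⟨⟨Equiv.ofBijective ε hbij, fun {n} F x => ?_, fun r => isEmptyElim r⟩⟩
  let j : Finset C × Finset (Conjunct L C) :=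
    (insert (Structure.funMap F x) (Finset.univ.image x), {⟨n, F, x, Structure.funMap F x⟩})
  let x' : Fin n → D.X j := fun k => ⟨x k, by simp [j]⟩
  let y' : D.X j := ⟨Structure.funMap F x, by simp [j]⟩
  exact (D.funMap_eq_of_isValue
    ⟨j, x', y', fun k => hε j (x' k), hε j y', Finset.mem_singleton_self _, rfl⟩).symm

/-- An algebra whose finite subsets are embedded in `B` by homomorphisms is a limit algebra. -/
theorem isLimitAlgebra_of_exists_injOn [L.IsAlgebraic] {B C : Type w} [L.Structure B]
    [L.Structure C] (h : ∀ F : Finset C, ∃ g : C →[L] B, Set.InjOn g F) : IsLimitAlgebra L B C := by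
  classical
  refine ⟨_, _, inferInstance, inferInstance, finiteDiagrams L C, fun i => ?_,
    nonempty_equiv_limit_finiteDiagrams C⟩
  obtain ⟨g, hg⟩ := h i.1
  refine ⟨fun x => g x.1, fun x y e => Subtype.ext (hg x.2 y.2 e), fun c hc => ?_⟩
  exact (g.map_fun c.symbol _).symm.trans (congrArg g hc.2)

end LimitAlgebras

/-! ### Irreducible decomposition of the set of homomorphisms. -/

section Decomposition

/-- If intersections of sets `U i` reduce to finite subintersections, then every such intersection
is a finite union of sets which are irreducible with respect to the `U i`. -/
theorem exists_irreducible_decomposition {H ι : Type*} (U : ι → Set H)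
    (hN : ∀ S : Set ι, ∃ S₀ ⊆ S, S₀.Finite ∧ ⋂ i ∈ S, U i = ⋂ i ∈ S₀, U i) (S : Set ι) :
    ∃ F : Set (Set H), F.Finite ∧ ⋃₀ F = ⋂ i ∈ S, U i ∧
      ∀ Z ∈ F, ∀ T : Set ι, T.Finite → Z ⊆ ⋃ i ∈ T, U i → ∃ i ∈ T, Z ⊆ U i := by
  -- The index sets of a descending chain need not be nested, but their union reduces to a finite
  -- `S₀`. Some stage `m` has intersection inside that of `S₀`, hence inside the next one, against
  -- strictness.
  have hwf : WellFounded fun R S : Set ι => ⋂ i ∈ R, U i ⊂ ⋂ i ∈ S, U i := by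
    refine wellFounded_iff_isEmpty_descending_chain.2 ⟨fun ⟨f, hf⟩ => ?_⟩
    have hanti : Antitone fun n => ⋂ i ∈ f n, U i := antitone_nat_of_succ_le fun n => (hf n).subset
    obtain ⟨S₀, hS₀, hfin, heq⟩ := hN (⋃ n, f n)
    have hbd : ∀ i : S₀, ∃ n, i.1 ∈ f n := fun i => Set.mem_iUnion.1 (hS₀ i.2)
    choose n hn using hbd
    have := hfin.to_subtype
    obtain ⟨m, hm⟩ := Finite.bddAbove_range n
    refine (hf m).not_subset fun h hh => Set.mem_iInter₂.2 fun i hi => ?_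
    have hmem : h ∈ ⋂ i ∈ S₀, U i := Set.mem_iInter₂.2 fun i hi =>
      Set.mem_iInter₂.1 (hanti (hm ⟨⟨i, hi⟩, rfl⟩) hh) i (hn ⟨i, hi⟩)
    rw [← heq] at hmem
    exact Set.mem_iInter₂.1 hmem i (Set.mem_iUnion.2 ⟨m + 1, hi⟩)
  induction S using hwf.induction with
  | _ S ih =>
    -- A reducible intersection is cut by the finitely many `U i` covering it into strictly smaller
    -- ones. Taking `T = ∅` shows that the empty set is not irreducible, so the members of `F` are
    -- nonempty.
    by_cases hirr : ∀ T : Set ι, T.Finite → ⋂ i ∈ S, U i ⊆ ⋃ i ∈ T, U i →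
        ∃ i ∈ T, ⋂ i ∈ S, U i ⊆ U i
    · refine ⟨{⋂ i ∈ S, U i}, Set.finite_singleton _, Set.sUnion_singleton _, ?_⟩
      rintro _ rfl
      exact hirr
    · push Not at hirr
      obtain ⟨T, hT, hcov, hnot⟩ := hirr
      have hins : ∀ i, ⋂ l ∈ insert i S, U l = U i ∩ ⋂ l ∈ S, U l := fun i =>
        Set.biInter_insert i S U
      have hstep : ∀ i : T, _ := fun i => ih (insert i.1 S) <| by
        rw [hins]
        exact ⟨Set.inter_subset_right, fun h => hnot i i.2 fun x hx => (h hx).1⟩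
      choose F hF hU hirr using hstep
      have := hT.to_subtype
      refine ⟨⋃ i, F i, Set.finite_iUnion hF, ?_, ?_⟩
      · rw [Set.sUnion_iUnion]
        simp only [hU, hins]
        rw [← Set.iUnion_inter, Set.inter_eq_right]
        simpa only [Set.iUnion_coe_set] using hcov
      · intro Z hZ
        obtain ⟨i, hi⟩ := Set.mem_iUnion.1 hZ
        exact hirr i Z hi

variable {L : FirstOrder.Language.{u, v}} {B C : Type w} [L.Structure B] [L.Structure C]

/-- Choosing terms `τ x` for elements turns the condition `h x = h y` into the equation `τ x = τ y`
at the point `h ∘ c`. -/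
theorem EquationallyNoetherian.exists_finite_hom (hN : EquationallyNoetherian L B) {n : ℕ}
    (hn : 0 < n) {c : Fin n → C} (hc : Generates L c) (S : Set (C × C)) :
    ∃ S₀ ⊆ S, S₀.Finite ∧
      ⋂ e ∈ S, {h : C →[L] B | h e.1 = h e.2} = ⋂ e ∈ S₀, {h : C →[L] B | h e.1 = h e.2} := by
  choose τ hτ using hc
  let σ : C × C → Equation L n := Prod.map τ τ
  have hinj : Function.Injective τ := Function.LeftInverse.injective hτ
  obtain ⟨E, hE, hfin, hV⟩ := hN n hn (relationsOf L c ∪ σ '' S)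
  -- The relations of `c` in `E` hold at every `h ∘ c` and can be dropped. Finiteness uses that `τ`
  -- is injective, being a section of evaluation at `c`.
  refine ⟨S ∩ σ ⁻¹' E, Set.inter_subset_left,
    (hfin.preimage (hinj.prodMap hinj).injOn).subset Set.inter_subset_right,
    Set.Subset.antisymm (Set.biInter_subset_biInter_left Set.inter_subset_left) fun h hh => ?_⟩
  have hval : ∀ x, (τ x).realize (h ∘ c) = h x := fun x => by
    rw [HomClass.realize_term, hτ]
  have hp : h ∘ c ∈ zeroLocus B E := by
    intro e he
    obtain hrel | ⟨x, hx, rfl⟩ := hE he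
    · rw [HomClass.realize_term, HomClass.realize_term, show _ = _ from hrel]
    · refine (hval x.1).trans (Eq.trans ?_ (hval x.2).symm)
      exact Set.mem_iInter₂.1 hh x ⟨hx, he⟩
  rw [← hV] at hp
  refine Set.mem_iInter₂.2 fun x hx => ?_
  exact (hval x.1).symm.trans ((hp (σ x) (.inr ⟨x, hx, rfl⟩)).trans (hval x.2))

/-- The image of `C` in the power of `B` given by a set of homomorphisms. -/
abbrev imageOf [L.IsAlgebraic] (Z : Set (C →[L] B)) : L.Substructure (Z → B) :=
  (homPi fun g : Z => g.1).range

/-- The image of `C` under an irreducible set of homomorphisms to `B` is a limit algebra. -/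
theorem isLimitAlgebra_imageOf [L.IsAlgebraic] (Z : Set (C →[L] B))
    (hZ : ∀ T : Set (C × C), T.Finite → Z ⊆ ⋃ e ∈ T, {h | h e.1 = h e.2} →
      ∃ e ∈ T, Z ⊆ {h | h e.1 = h e.2}) : IsLimitAlgebra L B (imageOf Z) := by
  refine isLimitAlgebra_of_exists_injOn fun F => ?_
  choose σ hσ using fun d : imageOf Z => d.2
  -- Preimages in `C` of the pairs of distinct elements of `F`. No such pair is identified by all of
  -- `Z`, so by irreducibility some `g ∈ Z` identifies none of them.
  let T : Set (C × C) := (fun d : imageOf Z × imageOf Z => (σ d.1, σ d.2)) ''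
    {d ∈ (F : Set (imageOf Z)) ×ˢ (F : Set (imageOf Z)) | d.1 ≠ d.2}
  have hT : T.Finite :=
    ((F.finite_toSet.prod F.finite_toSet).subset (Set.sep_subset _ _)).image _
  have hcov : ¬ Z ⊆ ⋃ e ∈ T, {h | h e.1 = h e.2} := by
    intro h
    obtain ⟨_, ⟨d, hd, rfl⟩, hsub⟩ := hZ T hT h
    refine hd.2 (Subtype.ext ?_)
    rw [← hσ d.1, ← hσ d.2]
    exact funext fun g => hsub g.2
  obtain ⟨g, hg, hgT⟩ := Set.not_subset.1 hcov
  refine ⟨(projHom (⟨g, hg⟩ : Z)).comp (imageOf Z).subtype.toHom, fun x hx y hy e => ?_⟩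
  by_contra hne
  refine hgT (Set.mem_iUnion₂.2 ⟨_, ⟨(x, y), ⟨⟨hx, hy⟩, hne⟩, rfl⟩, ?_⟩)
  have hgx : ∀ d : imageOf Z, g (σ d) = d.1 ⟨g, hg⟩ := fun d => congrFun (hσ d) ⟨g, hg⟩
  exact (hgx x).trans (Eq.trans e (hgx y).symm)

theorem IsSeparatedBy.isFiniteSubdirectProductOfLimits [L.IsAlgebraic]
    (hN : EquationallyNoetherian L B) {n : ℕ} (hn : 0 < n) {c : Fin n → C} (hc : Generates L c)
    (h : IsSeparatedBy L B C) : IsFiniteSubdirectProductOfLimits L B C := by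
  -- The empty set of conditions makes the decomposed intersection the set of all homomorphisms `C →
  -- B`, so every separating homomorphism lies in some piece.
  obtain ⟨F, hF, hcov, hirr⟩ := exists_irreducible_decomposition
    (fun e : C × C => {h : C →[L] B | h e.1 = h e.2}) (hN.exists_finite_hom hn hc) ∅
  obtain ⟨k, Z, rfl⟩ := hF.fin_embedding
  refine ⟨k, fun i => .of (imageOf (Z i)),
    fun i => isLimitAlgebra_imageOf (Z i) (hirr _ (Set.mem_range_self i)), ?_⟩
  let r : ∀ i, C →[L] imageOf (Z i) := fun i =>
    Hom.codRestrict _ (homPi fun g : Z i => g.1) fun x => ⟨x, rfl⟩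
  refine ⟨Embedding.ofInjective (f := homPi r) fun x y e => ?_, ?_⟩
  · by_contra hne
    obtain ⟨g, hg⟩ := h x y hne
    have hmem : g ∈ ⋃₀ Set.range Z := by simp [hcov]
    obtain ⟨_, ⟨i, rfl⟩, hi⟩ := hmem
    exact hg (congrFun (congrArg Subtype.val (congrFun e i)) ⟨g, hi⟩)
  · rintro i ⟨_, x, rfl⟩
    exact ⟨x, rfl⟩

end Decomposition

end UnivAlgGeom

theorem theoremD (L : FirstOrder.Language.{u, v}) [L.IsAlgebraic]
    (A : Type w) [Nonempty A] [L.Structure A]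
    (B : Type w) [L[[A]].Structure B] (hB : UnivAlgGeom.IsAlgebraOver L A B)
    (hNoeth : UnivAlgGeom.EquationallyNoetherian L[[A]] B)
    (C : Type w) [L[[A]].Structure C] (hC : UnivAlgGeom.IsAlgebraOver L A C)
    (hfg : Structure.FG L[[A]] C) :
    List.TFAE
      [ UnivAlgGeom.MemQvar L[[A]] B C,
        UnivAlgGeom.quasiTheory L[[A]] B ⊆ UnivAlgGeom.quasiTheory L[[A]] C,
        UnivAlgGeom.MemPvar L[[A]] B C,
        UnivAlgGeom.EmbedsInPower L[[A]] B C,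
        UnivAlgGeom.IsSeparatedBy L[[A]] B C,
        UnivAlgGeom.IsFiniteSubdirectProductOfLimits L[[A]] B C,
        UnivAlgGeom.IsDefinedByCompleteAtomicType (UnivAlgGeom.quasiTheory L[[A]] B) C,
        UnivAlgGeom.IsCoordinateAlgebra L[[A]] B C ] := by
  have : L[[A]].IsAlgebraic := isAlgebraic_sum (L' := constantsOn A)
  obtain ⟨a⟩ := ‹Nonempty A›
  -- Coefficients are constants, so their interpretations inhabit `C`.
  have : Nonempty C := ⟨((L.con a : L[[A]].Constants) : C)⟩
  obtain ⟨n, c, hn, hc⟩ := UnivAlgGeom.exists_generates hfg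
  tfae_have 1 ↔ 2 := UnivAlgGeom.memQvar_iff_subset
  tfae_have 1 → 5 := UnivAlgGeom.MemQvar.isSeparatedBy hNoeth hn hc
  tfae_have 5 → 4 := UnivAlgGeom.IsSeparatedBy.embedsInPower
  tfae_have 4 → 3 := UnivAlgGeom.EmbedsInPower.memPvar
  tfae_have 3 → 5 := UnivAlgGeom.MemPvar.isSeparatedBy
  tfae_have 5 → 6 := UnivAlgGeom.IsSeparatedBy.isFiniteSubdirectProductOfLimits hNoeth hn hc
  tfae_have 6 → 1 := UnivAlgGeom.IsFiniteSubdirectProductOfLimits.memQvar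
  tfae_have 1 → 7 := UnivAlgGeom.MemQvar.isDefinedByCompleteAtomicType hc
  tfae_have 7 → 1 := UnivAlgGeom.IsDefinedByCompleteAtomicType.memQvar
  tfae_have 5 → 8 := UnivAlgGeom.IsSeparatedBy.isCoordinateAlgebra hc
  tfae_have 8 → 1 := fun h => h.isSeparatedBy.memQvar
  tfae_finish
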